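/- Let $d\ge 0$ and let $T_{ij}^{kl}\in\mathbb C$ ($1\le i,j,k,l\le d$) satisfy $T_{ij}^{kl}=\overline{T_{ji}^{lk}}$. The Wick algebra $W(T)$ is the $*$-algebra generated by $a_i,a_i^*$ ($1\le i\le d$) with relations $a_i^*a_j=\delta_{ij}1+\sum_{k,l}T_{ij}^{kl}a_la_k^*$. Let $\mathcal H$ be the Hilbert space with orthonormal basis $e_1,\dots,e_d$, let $\mathcal T(\mathcal H)=\bigoplus_{n\ge0}\mathcal H^{\otimes n}$ be its (algebraic) tensor algebra, and let $T=T^*$ be the operator on $\mathcal H\otimes\mathcal H$ with $T(e_k\otimes e_l)=\sum_{i,j}T_{ik}^{lj}e_i\otimes e_j$. On $\mathcal H^{\otimes n}$ let $T_i$ denote $T$ acting on the $i$-th and $(i+1)$-st factors, and set $$R_n=1+T_1+T_1T_2+\cdots+T_1T_2\cdots T_{n-1},\qquad P_2=R_2,\quad P_{n+1}=(1\otimes P_n)R_{n+1}.$$ The Fock representation $\lambda_0$ is the representation of $W(T)$ on $\mathcal T(\mathcal H)$ with $\lambda_0(a_i)X=e_i\otimes X$ and $\lambda_0(a_i^*)1=0$.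 A Fock inner product is a Hermitian sesquilinear form $\langle\cdot,\cdot\rangle_0$ on $\mathcal T(\mathcal H)$ with $\langle 1,1\rangle_0=1$ such that $\langle\lambda_0(w)X,Y\rangle_0=\langle X,\lambda_0(w^*)Y\rangle_0$ for all $w\in W(T)$ and $X,Y\in\mathcal T(\mathcal H)$. Suppose that $T$ is braided, i.e. $T_1T_2T_1=T_2T_1T_2$ on $\mathcal H^{\otimes3}$, and that $-1<T\le1$, i.e. $1+T$ is positive definite and $1-T$ is positive semidefinite. Then: 1. $P_n$ is positive definite for every $n\ge2$. 2. There is exactly one Fock inner product, and it is strictly positive: $\langle X,X\rangle_0>0$ for every $X\neq0$ in $\mathcal T(\mathcal H)$. 3. The kernel $\{X:\langle X,Y\rangle_0=0\text{ for all }Y\}$ of the Fock inner product is zero; hence the Fock representation acts, as a $*$-representation with respect to this inner product, on the whole space $\mathcal T(\mathcal H)$, no quotient being necessary. -/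

import Mathlib

open scoped ComplexOrder ComplexConjugate

/-- Coefficients `T_{ij}^{kl}` (written `coeff i j k l`) of a Wick algebra with `d` generators:
complex numbers with `T_{ij}^{kl} = conj T_{ji}^{lk}`. -/
structure WickCoeff (d : ℕ) where
  coeff : Fin d → Fin d → Fin d → Fin d → ℂ
  herm : ∀ i j k l, coeff i j k l = conj (coeff j i l k)

/-- The opposite algebra of a complex algebra `A`, with scalars acting through complex
conjugation. An algebra homomorphism `A → ConjOp A` is a conjugate-linear antimultiplicative
map `A → A`. -/
def ConjOp (A : Type) : Type := Aᵐᵒᵖ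

namespace ConjOp

instance {A : Type} [Ring A] : Ring (ConjOp A) := inferInstanceAs (Ring Aᵐᵒᵖ)

noncomputable instance {A : Type} [Ring A] [Algebra ℂ A] : Algebra ℂ (ConjOp A) :=
  RingHom.toAlgebra' ((algebraMap ℂ Aᵐᵒᵖ).comp (starRingEnd ℂ))
    (fun c x => Algebra.commutes (A := Aᵐᵒᵖ) (conj c) x)

/-- The identity map from `ConjOp A` to `A`, an additive antimultiplicative bijection. -/
def toBase {A : Type} (x : ConjOp A) : A := MulOpposite.unop x

/-- The identity map from `A` to `ConjOp A`. -/
def ofBase {A : Type} (x : A) : ConjOp A := MulOpposite.op x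

theorem toBase_ofBase {A : Type} (x : A) : toBase (ofBase x) = x := rfl

theorem toBase_mul {A : Type} [Ring A] (x y : ConjOp A) : toBase (x * y) = toBase y * toBase x := rfl

theorem toBase_add {A : Type} [Ring A] (x y : ConjOp A) : toBase (x + y) = toBase x + toBase y := rfl

theorem toBase_algebraMap {A : Type} [Ring A] [Algebra ℂ A] (c : ℂ) :
    toBase (algebraMap ℂ (ConjOp A) c) = algebraMap ℂ A (conj c) := rfl

theorem smul_ofBase {A : Type} [Ring A] [Algebra ℂ A] (c : ℂ) (x : A) : c • ofBase x = ofBase (conj c • x) := by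
  rw [Algebra.smul_def, Algebra.smul_def, Algebra.commutes (conj c) x]
  rfl

end ConjOp

namespace WickCoeff

variable {d : ℕ} (T : WickCoeff d)

/-! ### The Wick algebra as a `*`-algebra -/

/-- The free complex algebra on the symbols `a_i` (`Sum.inl i`) and `a_i^*` (`Sum.inr i`). -/
abbrev FreeGen (d : ℕ) : Type := FreeAlgebra ℂ (Fin d ⊕ Fin d)

/-- The basic relations `a_i^* a_j = δ_{ij} 1 + ∑_{k,l} T_{ij}^{kl} a_l a_k^*`. -/
inductive Rel : FreeGen d → FreeGen d → Prop
  | basic (i j : Fin d) : Rel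
      (FreeAlgebra.ι ℂ (Sum.inr i) * FreeAlgebra.ι ℂ (Sum.inl j))
      ((if i = j then 1 else 0) + ∑ k, ∑ l,
        T.coeff i j k l • (FreeAlgebra.ι ℂ (Sum.inl l) * FreeAlgebra.ι ℂ (Sum.inr k)))

/-- The Wick algebra `W(T)`. -/
def WickAlgebra : Type := RingQuot T.Rel

noncomputable instance : Ring T.WickAlgebra := inferInstanceAs (Ring (RingQuot T.Rel))

noncomputable instance : Algebra ℂ T.WickAlgebra :=
  inferInstanceAs (Algebra ℂ (RingQuot T.Rel))

/-- The quotient map from the free algebra onto `W(T)`. -/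
noncomputable def proj : FreeGen d →ₐ[ℂ] T.WickAlgebra := RingQuot.mkAlgHom ℂ T.Rel

/-- The generator `a_i` of `W(T)`. -/
noncomputable def a (i : Fin d) : T.WickAlgebra := T.proj (FreeAlgebra.ι ℂ (Sum.inl i))

/-- The generator `a_i^*` of `W(T)`. -/
noncomputable def aStar (i : Fin d) : T.WickAlgebra := T.proj (FreeAlgebra.ι ℂ (Sum.inr i))

theorem aStar_mul_a (i j : Fin d) :
    T.aStar i * T.a j =
      (if i = j then 1 else 0) + ∑ k, ∑ l, T.coeff i j k l • (T.a l * T.aStar k) := by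
  have h : T.proj _ = T.proj _ := RingQuot.mkAlgHom_rel ℂ (Rel.basic (T := T) i j)
  simpa [a, aStar, apply_ite T.proj] using h

/-- The universal property of `W(T)`. -/
noncomputable def lift {B : Type} [Ring B] [Algebra ℂ B] (x y : Fin d → B)
    (h : ∀ i j, y i * x j = (if i = j then 1 else 0) +
      ∑ k, ∑ l, T.coeff i j k l • (x l * y k)) : T.WickAlgebra →ₐ[ℂ] B :=
  RingQuot.liftAlgHom ℂ ⟨FreeAlgebra.lift ℂ (Sum.elim x y), by
    rintro _ _ ⟨i, j⟩
    simp [h, apply_ite (FreeAlgebra.lift ℂ (Sum.elim x y))]⟩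

theorem lift_proj {B : Type} [Ring B] [Algebra ℂ B] (x y : Fin d → B)
    (h : ∀ i j, y i * x j = (if i = j then 1 else 0) +
      ∑ k, ∑ l, T.coeff i j k l • (x l * y k)) (z : FreeGen d) :
    T.lift x y h (T.proj z) = FreeAlgebra.lift ℂ (Sum.elim x y) z :=
  RingQuot.liftAlgHom_mkAlgHom_apply ..

theorem lift_a {B : Type} [Ring B] [Algebra ℂ B] (x y : Fin d → B)
    (h : ∀ i j, y i * x j = (if i = j then 1 else 0) +
      ∑ k, ∑ l, T.coeff i j k l • (x l * y k)) (i : Fin d) :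
    T.lift x y h (T.a i) = x i := by
  simp [a, lift_proj]

theorem lift_aStar {B : Type} [Ring B] [Algebra ℂ B] (x y : Fin d → B)
    (h : ∀ i j, y i * x j = (if i = j then 1 else 0) +
      ∑ k, ∑ l, T.coeff i j k l • (x l * y k)) (i : Fin d) :
    T.lift x y h (T.aStar i) = y i := by
  simp [aStar, lift_proj]

theorem wick_induction {p : T.WickAlgebra → Prop} (hc : ∀ c : ℂ, p (algebraMap ℂ _ c))
    (ha : ∀ i, p (T.a i)) (hs : ∀ i, p (T.aStar i)) (hm : ∀ x y, p x → p y → p (x * y))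
    (hadd : ∀ x y, p x → p y → p (x + y)) (w : T.WickAlgebra) : p w := by
  obtain ⟨z, rfl⟩ : ∃ z, T.proj z = w := RingQuot.mkAlgHom_surjective ℂ T.Rel w
  induction z using FreeAlgebra.induction with
  | grade0 c => rw [AlgHom.commutes]; exact hc c
  | grade1 x => rcases x with i | i
                · exact ha i
                · exact hs i
  | mul x y hx hy => rw [map_mul]; exact hm _ _ hx hy
  | add x y hx hy => rw [map_add]; exact hadd _ _ hx hy

/-- The involution of `W(T)` as a homomorphism into the conjugate opposite algebra: the
conjugate-linear antimultiplicative map that interchanges `a_i` and `a_i^*`. -/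
noncomputable def invol : T.WickAlgebra →ₐ[ℂ] ConjOp T.WickAlgebra :=
  T.lift (fun i => ConjOp.ofBase (T.aStar i)) (fun i => ConjOp.ofBase (T.a i)) (by
    intro i j
    have h1 : ConjOp.ofBase (T.a i) * ConjOp.ofBase (T.aStar j)
        = ConjOp.ofBase (T.aStar j * T.a i) := rfl
    have h2 : ∀ k l, T.coeff i j k l • (ConjOp.ofBase (T.aStar l) * ConjOp.ofBase (T.a k))
        = ConjOp.ofBase (T.coeff j i l k • (T.a k * T.aStar l)) := by
      intro k l
      have h3 : ConjOp.ofBase (T.aStar l) * ConjOp.ofBase (T.a k)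
        = ConjOp.ofBase (T.a k * T.aStar l) := rfl
      rw [h3, ConjOp.smul_ofBase, T.herm j i l k]
    rw [h1, aStar_mul_a]
    simp_rw [h2]
    rw [Finset.sum_comm]
    let φ : T.WickAlgebra →+ ConjOp T.WickAlgebra := ⟨⟨ConjOp.ofBase, rfl⟩, fun _ _ => rfl⟩
    change φ _ = _ + ∑ x, ∑ y, φ _
    simp_rw [map_add, map_sum]
    congr 1
    by_cases hij : i = j
    · subst hij; simp; rfl
    · simp [hij, Ne.symm hij])

theorem invol_a (i : Fin d) : ConjOp.toBase (T.invol (T.a i)) = T.aStar i := by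
  rw [invol, lift_a, ConjOp.toBase_ofBase]

theorem invol_aStar (i : Fin d) : ConjOp.toBase (T.invol (T.aStar i)) = T.a i := by
  rw [invol, lift_aStar, ConjOp.toBase_ofBase]

noncomputable instance : StarRing T.WickAlgebra where
  star w := ConjOp.toBase (T.invol w)
  star_involutive w := by
    change ConjOp.toBase (T.invol (ConjOp.toBase (T.invol w))) = w
    induction w using T.wick_induction with
    | hc c => rw [AlgHom.commutes, ConjOp.toBase_algebraMap, AlgHom.commutes,
        ConjOp.toBase_algebraMap, Complex.conj_conj]
    | ha i => rw [invol_a, invol_aStar]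
    | hs i => rw [invol_aStar, invol_a]
    | hm x y hx hy => rw [map_mul, ConjOp.toBase_mul, map_mul, ConjOp.toBase_mul, hx, hy]
    | hadd x y hx hy => rw [map_add, ConjOp.toBase_add, map_add, ConjOp.toBase_add, hx, hy]
  star_mul x y := by rw [map_mul, ConjOp.toBase_mul]
  star_add x y := by rw [map_add, ConjOp.toBase_add]

theorem star_a (i : Fin d) : star (T.a i) = T.aStar i := T.invol_a i

instance : StarModule ℂ T.WickAlgebra where
  star_smul c w := by
    rw [Algebra.smul_def, star_mul, Algebra.smul_def, Algebra.commutes (star c)]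
    congr 1
    change ConjOp.toBase (T.invol _) = _
    rw [AlgHom.commutes, ConjOp.toBase_algebraMap]
    rfl

/-! ### The tensor algebra and the Fock representation -/

/-- The Hilbert space `H` with orthonormal basis `e_1, …, e_d`. -/
abbrev H (d : ℕ) : Type := EuclideanSpace ℂ (Fin d)

/-- The full tensor algebra of `H`. Its unit `1` is the vacuum vector. -/
abbrev TensH (d : ℕ) : Type := TensorAlgebra ℂ (H d)

/-- The basis vector `e_i`, as an element of the tensor algebra. -/
noncomputable def e (i : Fin d) : TensH d :=
  TensorAlgebra.ι ℂ ((EuclideanSpace.basisFun (Fin d) ℂ).toBasis i)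

/-- The elementary tensor `e_{i_1} ⊗ ⋯ ⊗ e_{i_n}`. -/
noncomputable def eWord (w : List (Fin d)) : TensH d := (w.map e).prod

/-- The basis of the tensor algebra consisting of the elementary tensors
`e_{i_1} ⊗ ⋯ ⊗ e_{i_n}`, `n ≥ 0`. -/
noncomputable def wordBasis (d : ℕ) : Module.Basis (FreeMonoid (Fin d)) ℂ (TensH d) :=
  (EuclideanSpace.basisFun (Fin d) ℂ).toBasis.tensorAlgebra

theorem wordBasis_apply (w : FreeMonoid (Fin d)) : wordBasis d w = eWord w.toList := by
  induction w using FreeMonoid.inductionOn' with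
  | one =>
    simp [wordBasis, Module.Basis.tensorAlgebra, eWord, FreeAlgebra.basisFreeMonoid,
      ← MonoidAlgebra.one_def]
  | of_mul i w ih =>
    have : wordBasis d (FreeMonoid.of i * w) = e i * wordBasis d w := by
      have h : MonoidAlgebra.single (FreeMonoid.of i * w) (1 : ℂ) =
          MonoidAlgebra.single (FreeMonoid.of i) 1 * MonoidAlgebra.single w 1 := by
        simp [MonoidAlgebra.single_mul_single]
      simp [wordBasis, Module.Basis.tensorAlgebra, e, FreeAlgebra.basisFreeMonoid, h,
        FreeAlgebra.equivMonoidAlgebraFreeMonoid, MonoidAlgebra.lift_single,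
        -MonoidAlgebra.single_mul_single]
    rw [this, ih]
    simp [eWord]

/-- The Fock annihilators on elementary tensors, forced by `λ₀(a_i^*) 1 = 0` and by the basic
relations: `λ₀(a_i^*)(e_j ⊗ X) = δ_{ij} X + ∑_{k,l} T_{ij}^{kl} e_l ⊗ λ₀(a_k^*) X`. -/
noncomputable def annihWord : List (Fin d) → Fin d → TensH d
  | [], _ => 0
  | j :: w, i => (if i = j then eWord w else 0) +
      ∑ k, ∑ l, T.coeff i j k l • (e l * annihWord w k)

/-- The creation operator `X ↦ e_i ⊗ X`. -/
noncomputable def creation (i : Fin d) : Module.End ℂ (TensH d) := LinearMap.mulLeft ℂ (e i)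

/-- The Fock annihilation operator, extended linearly from elementary tensors. -/
noncomputable def annihilation (i : Fin d) : Module.End ℂ (TensH d) :=
  (wordBasis d).constr ℂ (fun w => T.annihWord w.toList i)

theorem annihilation_eWord (i : Fin d) (w : List (Fin d)) :
    T.annihilation i (eWord w) = T.annihWord w i := by
  have h := wordBasis_apply (FreeMonoid.ofList w)
  rw [FreeMonoid.toList_ofList] at h
  rw [annihilation, ← h, Module.Basis.constr_basis, FreeMonoid.toList_ofList]

theorem annihilation_mul_creation (i j : Fin d) :
    T.annihilation i * creation j = (if i = j then 1 else 0) +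
      ∑ k, ∑ l, T.coeff i j k l • (creation l * T.annihilation k) := by
  refine (wordBasis d).ext fun w => ?_
  rw [wordBasis_apply]
  have h : creation j (eWord w.toList) = eWord (j :: w.toList) := by
    simp [creation, eWord]
  rw [Module.End.mul_apply, h, annihilation_eWord, annihWord, LinearMap.add_apply]
  congr 1
  · split_ifs <;> simp
  · simp [LinearMap.sum_apply, annihilation_eWord, creation]

/-- The Fock representation `λ₀` of `W(T)` on the tensor algebra. -/
noncomputable def fock : T.WickAlgebra →ₐ[ℂ] Module.End ℂ (TensH d) :=
  T.lift creation T.annihilation T.annihilation_mul_creation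

theorem fock_a (i : Fin d) (X : TensH d) : T.fock (T.a i) X = e i * X := by
  rw [fock, lift_a, creation, LinearMap.mulLeft_apply]

theorem fock_aStar_one (i : Fin d) : T.fock (T.aStar i) 1 = 0 := by
  have h : (1 : TensH d) = eWord [] := by simp [eWord]
  rw [fock, lift_aStar, h, annihilation_eWord, annihWord]

/-- `B` is a Fock inner product: a Hermitian sesquilinear form (conjugate-linear in the first
variable) on the tensor algebra, normalized on the vacuum, for which the Fock representation is
a `*`-representation. -/
structure IsFockInnerProduct (B : TensH d →ₗ⋆[ℂ] TensH d →ₗ[ℂ] ℂ) : Prop where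
  hermitian : ∀ X Y, conj (B X Y) = B Y X
  vacuum : B 1 1 = 1
  star_rep : ∀ (w : T.WickAlgebra) (X Y : TensH d),
    B (T.fock w X) Y = B X (T.fock (star w) Y)

/-! ### The operators `T`, `T_i`, `R_n`, `P_n`

Operators on the `n`-th tensor power of `H` are given by their matrices in the orthonormal basis
`e_{u 0} ⊗ ⋯ ⊗ e_{u (n-1)}`, indexed by `u : Fin n → Fin d`. -/

/-- The operator `T` on `H ⊗ H`: `T (e_k ⊗ e_l) = ∑_{i,j} T_{ik}^{lj} e_i ⊗ e_j`. -/
def op : Matrix (Fin d × Fin d) (Fin d × Fin d) ℂ :=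
  Matrix.of fun u v => T.coeff u.1 v.1 v.2 u.2

/-- `1 ⊗ ⋯ ⊗ 1 ⊗ T ⊗ 1 ⊗ ⋯ ⊗ 1` on the `(n+1)`-st tensor power, where `T` acts on the adjacent
factors with numbers `i` and `i + 1` (counted from `0`). -/
def opAt (n : ℕ) (i : Fin n) : Matrix (Fin (n + 1) → Fin d) (Fin (n + 1) → Fin d) ℂ :=
  Matrix.of fun u v =>
    if ∀ m, m ≠ i.castSucc → m ≠ i.succ → u m = v m then
      T.op (u i.castSucc, u i.succ) (v i.castSucc, v i.succ)
    else 0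

/-- The braid condition `T_1 T_2 T_1 = T_2 T_1 T_2` on `H ⊗ H ⊗ H`. -/
def IsBraided : Prop :=
  T.opAt 2 0 * T.opAt 2 1 * T.opAt 2 0 = T.opAt 2 1 * T.opAt 2 0 * T.opAt 2 1

/-- `R_{n+1} = 1 + T_1 + T_1 T_2 + ⋯ + T_1 T_2 ⋯ T_n` on the `(n+1)`-st tensor power. -/
def R (n : ℕ) : Matrix (Fin (n + 1) → Fin d) (Fin (n + 1) → Fin d) ℂ :=
  ∑ k ∈ Finset.range (n + 1), ((List.ofFn (T.opAt n)).take k).prod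

/-- `1 ⊗ A`, where `1` is the identity of the first tensor factor `H`. -/
def oneTensor {n : ℕ} (A : Matrix (Fin n → Fin d) (Fin n → Fin d) ℂ) :
    Matrix (Fin (n + 1) → Fin d) (Fin (n + 1) → Fin d) ℂ :=
  Matrix.of fun u v => if u 0 = v 0 then A (Fin.tail u) (Fin.tail v) else 0

/-- The operators `P_n`, with `P_{n+1} = (1 ⊗ P_n) R_{n+1}`; here `P_0 = P_1 = 1` and
`P_2 = R_2 = 1 + T`. -/
def P : (n : ℕ) → Matrix (Fin n → Fin d) (Fin n → Fin d) ℂ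
  | 0 => 1
  | n + 1 => oneTensor (P n) * T.R n

end WickCoeff

/-!
The Fock inner product is forced to be `⟨e_i ⊗ X, Y⟩ = ⟨X, λ₀(a_i^*) Y⟩` with
`⟨1, e_i ⊗ Y⟩ = 0`. Since `λ₀(a_i^*)` acts on `H^{⊗n}` as `R_n` followed by the removal of a first
factor `e_i` (`annihWord_ofFn`), this form makes different tensor powers orthogonal and is given by
the matrix `P_n` on the `n`-th one (`wordFunctional_eWord`). The `P_n` are Hermitian without any
assumption on `T` (`isHermitian_P`), so existence and uniqueness hold in general, and everything
else follows once all `P_n` are positive definite (`posDef_P`).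

For real `q ∈ [0, 1]` the hypotheses pass from `T` to `q T`, and `P_n(0) = 1`. A continuous path of
Hermitian matrices that starts at a positive definite one and stays invertible stays positive
definite (`posDef_of_path`), so it suffices that `P_n`, and by its recursive definition `R_n`, is
invertible whenever `T` is braided with `-1 < T ≤ 1`.

The key is an induction on `k` for `S_k = 1 + T_1 + ⋯ + T_1 ⋯ T_k`. With `c = T_1 ⋯ T_k`, the braid
relations give `S_k (1 - c) = (1 - T_1 c) S_{k-1}` (`sum_cycleProd_mul_one_sub`). If `S_kᴴ x = 0`,
then `S_{k-1}ᴴ (1 - cᴴ T_1) x = 0`, so `x = cᴴ T_1 x = T_k ⋯ T_1 T_1 x` by the induction hypothesis.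
All `T_i` are contractions that preserve the length of their fixed vectors only, because
`-1 < T_i ≤ 1`; so every `T_i` fixes `x`, and `0 = S_kᴴ x = (k + 1) x`
(`isUnit_sum_cycleProd`).
-/

/-! ### Partial products of a braided sequence -/

section Cycles

variable {A : Type*} [Ring A]

/-- The partial product `t 0 * t 1 * ⋯ * t (k - 1)`. -/
def cycleProd (t : ℕ → A) : ℕ → A
  | 0 => 1
  | k + 1 => cycleProd t k * t k

theorem cycleProd_succ' (t : ℕ → A) (k : ℕ) :
    cycleProd t (k + 1) = t 0 * cycleProd (fun i => t (i + 1)) k := by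
  induction k with
  | zero => simp [cycleProd]
  | succ k ih => rw [cycleProd, ih, cycleProd, mul_assoc]

/-- The first `n` members of the sequence `t` satisfy the relations of the braid monoid. -/
structure BraidRelations (t : ℕ → A) (n : ℕ) : Prop where
  braid : ∀ i, i + 1 < n → t i * t (i + 1) * t i = t (i + 1) * t i * t (i + 1)
  comm : ∀ i j, i + 2 ≤ j → j < n → t i * t j = t j * t i

variable {t : ℕ → A} {n : ℕ}

theorem BraidRelations.mono (h : BraidRelations t n) {m : ℕ} (hm : m ≤ n) :
    BraidRelations t m :=
  ⟨fun i hi => h.braid i (hi.trans_le hm), fun i j hij hj => h.comm i j hij (hj.trans_le hm)⟩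

theorem BraidRelations.cycleProd_comm (h : BraidRelations t n) {k j : ℕ} (hkj : k < j)
    (hj : j < n) : cycleProd t k * t j = t j * cycleProd t k := by
  induction k with
  | zero => simp [cycleProd]
  | succ k ih =>
    rw [cycleProd, mul_assoc, h.comm k j hkj hj, ← mul_assoc, ih (by omega), mul_assoc]

/-- Conjugation by the cycle `t 0 * ⋯ * t (k - 1)` shifts the generators by one. -/
theorem BraidRelations.mul_cycleProd (h : BraidRelations t n) {i k : ℕ} (hik : i + 1 < k)
    (hk : k ≤ n) : t (i + 1) * cycleProd t k = cycleProd t k * t i := by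
  induction k with
  | zero => omega
  | succ k ih =>
    rcases Nat.lt_succ_iff_lt_or_eq.1 hik with hlt | rfl
    · rw [cycleProd, ← mul_assoc, ih hlt (by omega), mul_assoc, h.comm i k hlt (by omega),
        mul_assoc]
    · simp only [cycleProd]
      rw [← mul_assoc, ← mul_assoc, ← h.cycleProd_comm (Nat.lt_succ_self i) (by omega)]
      simp only [mul_assoc]
      rw [← mul_assoc (t (i + 1)), ← h.braid i (by omega), mul_assoc]

theorem BraidRelations.cycleProd_succ_mul (h : BraidRelations t n) {j k : ℕ} (hjk : j + 1 ≤ k)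
    (hk : k ≤ n) : cycleProd t (j + 1) * cycleProd t k
      = t 0 * cycleProd t k * cycleProd t j := by
  induction j with
  | zero => simp [cycleProd]
  | succ j ih =>
    rw [cycleProd, mul_assoc, h.mul_cycleProd hjk hk, ← mul_assoc, ih (by omega), mul_assoc,
      ← cycleProd]

/-- With `c = t 0 * ⋯ * t (k - 1)` and `R k = ∑_{j ≤ k} t 0 * ⋯ * t (j - 1)`, this is the relation
`R k * (1 - c) = (1 - t 0 * c) * R (k - 1)`, which allows induction on `k`. -/
theorem BraidRelations.sum_cycleProd_mul_one_sub (h : BraidRelations t n) {k : ℕ} (hk : k ≤ n) :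
    (∑ j ∈ Finset.range (k + 1), cycleProd t j) * (1 - cycleProd t k) =
      (1 - t 0 * cycleProd t k) * ∑ j ∈ Finset.range k, cycleProd t j := by
  have h1 : (∑ j ∈ Finset.range (k + 1), cycleProd t j) * cycleProd t k =
      t 0 * cycleProd t k * (∑ j ∈ Finset.range k, cycleProd t j) + cycleProd t k := by
    rw [Finset.sum_mul, Finset.sum_range_succ', Finset.mul_sum]
    congr 1
    · refine Finset.sum_congr rfl fun j hj => h.cycleProd_succ_mul ?_ hk
      have := Finset.mem_range.1 hj
      omega
    · simp [cycleProd]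
  rw [mul_sub, mul_one, h1, sub_mul, one_mul, Finset.sum_range_succ]
  abel

end Cycles

/-! ### Strict contractions away from their fixed vectors -/

namespace Matrix

variable {ι : Type*} [Fintype ι]

open scoped Matrix

/-- A matrix that does not increase the Euclidean length of any vector, and keeps it only on its
fixed vectors. -/
def FixOrShrink (A : Matrix ι ι ℂ) : Prop :=
  ∀ x : ι → ℂ, star (A *ᵥ x) ⬝ᵥ (A *ᵥ x) ≤ star x ⬝ᵥ x ∧
    (star (A *ᵥ x) ⬝ᵥ (A *ᵥ x) = star x ⬝ᵥ x → A *ᵥ x = x)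

theorem star_mulVec_dotProduct {m : Type*} [Fintype m] (A : Matrix m ι ℂ) (x : ι → ℂ) (y : m → ℂ) :
    star (A *ᵥ x) ⬝ᵥ y = star x ⬝ᵥ (Aᴴ *ᵥ y) := by
  rw [star_mulVec, dotProduct_mulVec]

/-- The spectrum of `A` lies in `(-1, 1]`; the proof writes `2 (1 - A²)` as
`(1 - A) (1 + A) (1 - A) + (1 + A) (1 - A) (1 + A)`. -/
theorem FixOrShrink.of_posDef_of_posSemidef [DecidableEq ι] {A : Matrix ι ι ℂ}
    (h1 : (1 + A).PosDef) (h2 : (1 - A).PosSemidef) : FixOrShrink A := by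
  have hA : Aᴴ = A := by
    have h := h1.isHermitian
    rw [IsHermitian, conjTranspose_add, conjTranspose_one] at h
    exact add_left_cancel h
  intro x
  have key : 2 * (star x ⬝ᵥ x - star (A *ᵥ x) ⬝ᵥ (A *ᵥ x)) =
      star ((1 - A) *ᵥ x) ⬝ᵥ ((1 + A) *ᵥ ((1 - A) *ᵥ x)) +
      star ((1 + A) *ᵥ x) ⬝ᵥ ((1 - A) *ᵥ ((1 + A) *ᵥ x)) := by
    simp only [star_mulVec_dotProduct, conjTranspose_add, conjTranspose_sub, conjTranspose_one,
      hA, mulVec_mulVec]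
    rw [← dotProduct_add, ← add_mulVec]
    have : (1 - A) * ((1 + A) * (1 - A)) + (1 + A) * ((1 - A) * (1 + A)) =
        (2 : ℂ) • (1 - A * A) := by
      rw [two_smul]; noncomm_ring
    rw [this, smul_mulVec, dotProduct_smul, sub_mulVec, dotProduct_sub, one_mulVec, smul_eq_mul]
  have hp := h1.posSemidef.dotProduct_mulVec_nonneg ((1 - A) *ᵥ x)
  have hq := h2.dotProduct_mulVec_nonneg ((1 + A) *ᵥ x)
  constructor
  · have : 0 ≤ (2 : ℂ) * (star x ⬝ᵥ x - star (A *ᵥ x) ⬝ᵥ (A *ᵥ x)) := key ▸ add_nonneg hp hq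
    have h3 := mul_nonneg (show (0 : ℂ) ≤ 2⁻¹ by positivity) this
    rw [inv_mul_cancel_left₀ two_ne_zero] at h3
    exact sub_nonneg.1 h3
  · intro heq
    rw [heq, sub_self, mul_zero] at key
    by_contra hne
    have hx : (1 - A) *ᵥ x ≠ 0 := by
      rw [sub_mulVec, one_mulVec]
      exact sub_ne_zero.2 (Ne.symm hne)
    exact (add_pos_of_pos_of_nonneg (h1.dotProduct_mulVec_pos hx) hq).ne key

/-- A vector fixed by `t 0, …, t (k - 1)` is fixed by the adjoint of their product. -/
theorem cycleProd_conjTranspose_mulVec [DecidableEq ι] {t : ℕ → Matrix ι ι ℂ} {k : ℕ}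
    (hH : ∀ i < k, (t i)ᴴ = t i) {x : ι → ℂ} (hx : ∀ i < k, t i *ᵥ x = x) :
    (cycleProd t k)ᴴ *ᵥ x = x := by
  induction k with
  | zero => simp [cycleProd]
  | succ k ih =>
    rw [cycleProd, conjTranspose_mul, hH k (by omega), ← mulVec_mulVec,
      ih (fun i hi => hH i (by omega)) (fun i hi => hx i (by omega)), hx k (by omega)]

/-- If `t (k - 1) * ⋯ * t 0` preserves the length of `x`, then every factor fixes `x`. -/
theorem fixed_of_cycleProd [DecidableEq ι] {t : ℕ → Matrix ι ι ℂ} {k : ℕ}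
    (hH : ∀ i < k, (t i)ᴴ = t i) (hS : ∀ i < k, FixOrShrink (t i)) (x : ι → ℂ) :
    star ((cycleProd t k)ᴴ *ᵥ x) ⬝ᵥ ((cycleProd t k)ᴴ *ᵥ x) ≤ star x ⬝ᵥ x ∧
    (star ((cycleProd t k)ᴴ *ᵥ x) ⬝ᵥ ((cycleProd t k)ᴴ *ᵥ x) = star x ⬝ᵥ x →
      ∀ i < k, t i *ᵥ x = x) := by
  induction k with
  | zero => simp [cycleProd]
  | succ k ih =>
    obtain ⟨ih1, ih2⟩ := ih (fun i hi => hH i (by omega)) (fun i hi => hS i (by omega))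
    obtain ⟨s1, s2⟩ := hS k (by omega) ((cycleProd t k)ᴴ *ᵥ x)
    rw [cycleProd, conjTranspose_mul, hH k (by omega), ← mulVec_mulVec]
    refine ⟨s1.trans ih1, fun heq i hi => ?_⟩
    have h1 := ih2 (le_antisymm ih1 (heq ▸ s1))
    have h2 := cycleProd_conjTranspose_mulVec (fun j hj => hH j (by omega)) h1
    rcases Nat.lt_succ_iff_lt_or_eq.1 hi with hlt | rfl
    · exact h1 i hlt
    · rw [h2] at s2 heq
      exact s2 heq

/-- For a braided sequence of Hermitian matrices with spectra in `(-1, 1]` the sum of the cycles is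
invertible. A vector `x` in the kernel of its adjoint satisfies `t (k - 1) * ⋯ * t 0 * t 0 * x = x`
by `BraidRelations.sum_cycleProd_mul_one_sub` and induction; so it is fixed by all `t i`, and the
sum of the cycles multiplies it by `k + 1`. -/
theorem isUnit_sum_cycleProd [DecidableEq ι] {t : ℕ → Matrix ι ι ℂ} {k : ℕ}
    (h : BraidRelations t k) (hH : ∀ i < k, (t i)ᴴ = t i) (hS : ∀ i < k, FixOrShrink (t i)) :
    IsUnit (∑ j ∈ Finset.range (k + 1), cycleProd t j) := by
  induction k with
  | zero => simp [cycleProd]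
  | succ k ih =>
    have ih' := ih (h.mono (by omega)) (fun i hi => hH i (by omega)) (fun i hi => hS i (by omega))
    have hrel := congrArg conjTranspose (h.sum_cycleProd_mul_one_sub le_rfl)
    set S := ∑ j ∈ Finset.range (k + 1 + 1), cycleProd t j with hSdef
    rw [← isUnit_conjTranspose, ← mulVec_injective_iff_isUnit,
      ← coe_mulVecLin, injective_iff_map_eq_zero]
    intro x hx
    rw [mulVecLin_apply] at hx
    rw [conjTranspose_mul, conjTranspose_mul, conjTranspose_sub, conjTranspose_sub,
      conjTranspose_mul, conjTranspose_one, hH 0 (by omega)] at hrel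
    have h0 := congrArg (· *ᵥ x) hrel
    simp only [← mulVec_mulVec, hx, mulVec_zero] at h0
    have hinj := mulVec_injective_iff_isUnit.2 ((isUnit_conjTranspose _).2 ih')
    have h1 := hinj (h0.symm.trans (mulVec_zero _).symm)
    rw [sub_mulVec, one_mulVec, sub_eq_zero, ← mulVec_mulVec] at h1
    obtain ⟨p1, p2⟩ := fixed_of_cycleProd hH hS (t 0 *ᵥ x)
    obtain ⟨q1, q2⟩ := hS 0 (by omega) x
    rw [← h1] at p1 p2
    have h2 : t 0 *ᵥ x = x := q2 (le_antisymm q1 p1)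
    rw [h2] at p2
    have hfix := p2 rfl
    have hc : ∀ j ≤ k + 1, (cycleProd t j)ᴴ *ᵥ x = x := fun j hj =>
      cycleProd_conjTranspose_mulVec (fun i hi => hH i (by omega)) (fun i hi => hfix i (by omega))
    have hx' : ((k + 2 : ℕ) : ℂ) • x = 0 := by
      rw [← hx, hSdef, conjTranspose_sum, sum_mulVec, Finset.sum_congr rfl
        (fun j hj => hc j (Nat.lt_succ_iff.1 (Finset.mem_range.1 hj)))]
      rw [Finset.sum_const, Finset.card_range, Nat.cast_smul_eq_nsmul]
    exact (smul_eq_zero.1 hx').resolve_left (Nat.cast_ne_zero.2 (by omega))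

/-! ### Deformation of positive definite matrices -/

/-- Along a continuous path of Hermitian matrices positive definiteness is not lost as long as the
matrices stay invertible. -/
theorem posDef_of_path [DecidableEq ι] {M : ℝ → Matrix ι ι ℂ} (hc : Continuous M)
    (hH : ∀ q ∈ Set.Icc (0 : ℝ) 1, (M q).IsHermitian) (hU : ∀ q ∈ Set.Icc (0 : ℝ) 1, IsUnit (M q))
    (h0 : (M 0).PosDef) : (M 1).PosDef := by
  let g : ℝ → (ι → ℂ) → ℝ := fun q x => (star x ⬝ᵥ (M q *ᵥ x)).re
  have hg : Continuous (fun p : ℝ × (ι → ℂ) => g p.1 p.2) := by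
    refine Complex.continuous_re.comp ?_
    refine Continuous.dotProduct (continuous_star.comp continuous_snd) ?_
    exact Continuous.matrix_mulVec (hc.comp continuous_fst) continuous_snd
  have him : ∀ q ∈ Set.Icc (0 : ℝ) 1, ∀ x, (star x ⬝ᵥ (M q *ᵥ x)).im = 0 := fun q hq x =>
    (hH q hq).im_star_dotProduct_mulVec_self x
  have hpsd : ∀ q ∈ Set.Icc (0 : ℝ) 1, ((M q).PosSemidef ↔ ∀ x, 0 ≤ g q x) := fun q hq =>
    ⟨fun h x => (Complex.nonneg_iff.1 (h.dotProduct_mulVec_nonneg x)).1, fun h =>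
      .of_dotProduct_mulVec_nonneg (hH q hq) fun x =>
        Complex.nonneg_iff.2 ⟨h x, (him q hq x).symm⟩⟩
  have hsub : Set.Icc (0 : ℝ) 1 ⊆ {q | ∀ x, 0 ≤ g q x} := by
    refine IsClosed.Icc_subset_of_forall_mem_nhdsWithin ?_ ?_ ?_
    · refine IsClosed.inter ?_ isClosed_Icc
      simp only [Set.ofPred_forall]
      exact isClosed_iInter fun x => isClosed_le continuous_const
        (hg.comp (Continuous.prodMk continuous_id continuous_const))
    · exact (hpsd 0 ⟨le_rfl, zero_le_one⟩).1 h0.posSemidef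
    · rintro q ⟨hq, hq'⟩
      have hqI : q ∈ Set.Icc (0 : ℝ) 1 := ⟨hq'.1, hq'.2.le⟩
      have hpd : (M q).PosDef := (((hpsd q hqI).2 hq).posDef_iff_isUnit).2 (hU q hqI)
      -- positivity is open in `q`, uniformly on the compact unit sphere
      have hev : ∀ᶠ q' in nhds q, ∀ x ∈ Metric.sphere (0 : ι → ℂ) 1, 0 < g q' x := by
        refine (isCompact_sphere _ _).eventually_forall_of_forall_eventually fun x hx => ?_
        have hx0 : x ≠ 0 := by
          rintro rfl
          simp at hx
        have := (Complex.pos_iff.1 (hpd.dotProduct_mulVec_pos hx0)).1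
        exact hg.continuousAt.eventually (lt_mem_nhds this)
      refine nhdsWithin_le_nhds (hev.mono fun q' h x => ?_)
      rcases eq_or_ne x 0 with rfl | hx
      · simp [g]
      · have hn : ‖x‖ ≠ 0 := norm_ne_zero_iff.2 hx
        have h1 := h (((‖x‖⁻¹ : ℝ) : ℂ) • x) (by simp [norm_smul, hn])
        simp only [g, star_smul, mulVec_smul, smul_dotProduct, dotProduct_smul, smul_eq_mul,
          RCLike.star_def, Complex.conj_ofReal, Complex.re_ofReal_mul] at h1
        have hp : 0 < ‖x‖⁻¹ := by positivity
        exact (pos_of_mul_pos_right (pos_of_mul_pos_right h1 hp.le) hp.le).le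
  have h1 : (1 : ℝ) ∈ Set.Icc (0 : ℝ) 1 := ⟨zero_le_one, le_rfl⟩
  exact (((hpsd 1 h1).2 (hsub h1)).posDef_iff_isUnit).2 (hU 1 h1)

end Matrix

/-! ### Operators acting on some of the tensor factors -/

namespace Matrix

open scoped Kronecker Matrix

section ActAt

variable {κ ι μ α : Type*}

open Classical in
/-- The operator on the tensor power indexed by `ι` that acts as `A` on the factors `f k`, `k : κ`,
and as the identity on the others. It is meaningful for injective `f` only. -/
noncomputable def actAt (f : κ → ι) (A : Matrix (κ → α) (κ → α) ℂ) : Matrix (ι → α) (ι → α) ℂ :=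
  of fun u v => if ∀ m, m ∉ Set.range f → u m = v m then A (u ∘ f) (v ∘ f) else 0

theorem actAt_add (f : κ → ι) (A B : Matrix (κ → α) (κ → α) ℂ) :
    actAt f (A + B) = actAt f A + actAt f B := by
  ext u v
  simp only [actAt, of_apply, add_apply]
  split_ifs <;> simp

theorem actAt_sub (f : κ → ι) (A B : Matrix (κ → α) (κ → α) ℂ) :
    actAt f (A - B) = actAt f A - actAt f B := by
  ext u v
  simp only [actAt, of_apply, sub_apply]
  split_ifs <;> simp

theorem actAt_sum (f : κ → ι) {γ : Type*} (s : Finset γ) (A : γ → Matrix (κ → α) (κ → α) ℂ) :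
    actAt f (∑ j ∈ s, A j) = ∑ j ∈ s, actAt f (A j) :=
  map_sum (AddMonoidHom.mk' (actAt f) (actAt_add f)) A s

theorem conjTranspose_actAt (f : κ → ι) (A : Matrix (κ → α) (κ → α) ℂ) :
    (actAt f A)ᴴ = actAt f Aᴴ := by
  ext u v
  have h : (∀ m, m ∉ Set.range f → v m = u m) ↔ ∀ m, m ∉ Set.range f → u m = v m := by
    simp only [eq_comm]
  simp only [actAt, of_apply, conjTranspose_apply]
  by_cases hm : ∀ m, m ∉ Set.range f → u m = v m
  · rw [if_pos hm, if_pos (h.2 hm)]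
  · rw [if_neg hm, if_neg (mt h.1 hm), star_zero]

theorem actAt_actAt {f : κ → ι} (hf : f.Injective) (g : μ → κ) (A : Matrix (μ → α) (μ → α) ℂ) :
    actAt f (actAt g A) = actAt (f ∘ g) A := by
  ext u v
  have h : (∀ m, m ∉ Set.range (f ∘ g) → u m = v m) ↔
      (∀ m, m ∉ Set.range f → u m = v m) ∧
        ∀ k, k ∉ Set.range g → (u ∘ f) k = (v ∘ f) k := by
    constructor
    · refine fun h => ⟨fun m hm => h m fun ⟨k, hk⟩ => hm ⟨g k, hk⟩, fun k hk => h (f k) ?_⟩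
      rintro ⟨l, hl⟩
      exact hk ⟨l, hf hl⟩
    · rintro ⟨h1, h2⟩ m hm
      by_cases hm' : m ∈ Set.range f
      · obtain ⟨k, rfl⟩ := hm'
        exact h2 k fun ⟨l, hl⟩ => hm ⟨l, congrArg f hl⟩
      · exact h1 m hm'
  simp only [actAt, of_apply]
  rw [← ite_and]
  by_cases hm : ∀ m, m ∉ Set.range (f ∘ g) → u m = v m
  · rw [if_pos hm, if_pos (h.1 hm)]
    rfl
  · rw [if_neg hm, if_neg (mt h.2 hm)]

/-- Splitting of a basis index of the tensor power into the factors in the range of `f` and the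
remaining ones. -/
noncomputable def splitEquiv (α : Type*) (f : κ → ι) (hf : f.Injective) :
    (ι → α) ≃ (κ → α) × ({m // m ∉ Set.range f} → α) :=
  Equiv.ofBijective (fun u => (u ∘ f, fun m => u m)) (by
    classical
    constructor
    · intro u v huv
      obtain ⟨h1, h2⟩ := Prod.mk.inj huv
      funext m
      by_cases hm : m ∈ Set.range f
      · obtain ⟨k, rfl⟩ := hm
        exact congrFun h1 k
      · exact congrFun h2 ⟨m, hm⟩
    · rintro ⟨p, q⟩
      refine ⟨fun m => if h : m ∈ Set.range f then p h.choose else q ⟨m, h⟩, ?_⟩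
      refine Prod.ext ?_ ?_
      · funext k
        have h : f k ∈ Set.range f := ⟨k, rfl⟩
        change dite _ _ _ = _
        rw [dif_pos h]
        exact congrArg p (hf h.choose_spec)
      · funext m
        exact dif_neg m.2)

theorem actAt_eq_kronecker {f : κ → ι} [DecidableEq ({m // m ∉ Set.range f} → α)]
    (hf : f.Injective) (A : Matrix (κ → α) (κ → α) ℂ) :
    actAt f A = (A ⊗ₖ (1 : Matrix ({m // m ∉ Set.range f} → α) _ ℂ)).submatrix
      (splitEquiv α f hf) (splitEquiv α f hf) := by
  ext u v
  simp only [actAt, of_apply, submatrix_apply, kroneckerMap_apply, one_apply, mul_ite, mul_one,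
    mul_zero]
  split_ifs with h1 h2 h2
  · rfl
  · exact (h2 (funext fun m => h1 m.1 m.2)).elim
  · exact (h1 fun m hm => congrFun h2 ⟨m, hm⟩).elim
  · rfl

theorem actAt_one [Fintype ι] [Fintype κ] [DecidableEq α] {f : κ → ι}
    (hf : f.Injective) : actAt f (1 : Matrix (κ → α) (κ → α) ℂ) = 1 := by
  classical
  rw [actAt_eq_kronecker hf, one_kronecker_one, submatrix_one_equiv]

variable [Fintype ι] [Fintype α] [DecidableEq ι] [DecidableEq α] {f : κ → ι}

open Classical in
theorem actAt_mul_actAt_apply {g : μ → ι} (hfg : Disjoint (Set.range f) (Set.range g))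
    (A : Matrix (κ → α) (κ → α) ℂ) (B : Matrix (μ → α) (μ → α) ℂ) (u v : ι → α) :
    (actAt f A * actAt g B) u v =
      if ∀ m, m ∉ Set.range f → m ∉ Set.range g → u m = v m then
        A (u ∘ f) (v ∘ f) * B (u ∘ g) (v ∘ g) else 0 := by
  have hd : ∀ m, m ∈ Set.range f → m ∉ Set.range g := fun m hm => Set.disjoint_left.1 hfg hm
  -- the only intermediate index that contributes: `v` on the range of `f`, and `u` elsewhere
  let w : ι → α := fun m => if m ∈ Set.range f then v m else u m
  have hwf : w ∘ f = v ∘ f := funext fun k => if_pos ⟨k, rfl⟩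
  have hwg : w ∘ g = u ∘ g := funext fun k => if_neg fun h => hd _ h ⟨k, rfl⟩
  rw [mul_apply, Finset.sum_eq_single w]
  · simp only [actAt, of_apply, hwf, hwg]
    rw [if_pos fun m hm => (if_neg hm).symm, mul_ite, mul_zero]
    refine if_congr ⟨fun h m hm hm' => ?_, fun h m hm => ?_⟩ rfl rfl
    · rw [← h m hm']
      exact (if_neg hm).symm
    · by_cases hm' : m ∈ Set.range f
      · exact if_pos hm'
      · exact (if_neg hm').trans (h m hm' hm)
  · intro b _ hb
    simp only [actAt, of_apply]
    by_cases h1 : ∀ m, m ∉ Set.range f → u m = b m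
    · rw [if_neg (c := ∀ m, m ∉ Set.range g → b m = v m), mul_zero]
      refine fun h2 => hb (funext fun m => ?_)
      by_cases hm : m ∈ Set.range f
      · exact (h2 m (hd m hm)).trans (if_pos hm).symm
      · exact (h1 m hm).symm.trans (if_neg hm).symm
    · rw [if_neg h1, zero_mul]
  · simp

/-- Operators that act on disjoint sets of tensor factors commute. -/
theorem actAt_commute {g : μ → ι} (hfg : Disjoint (Set.range f) (Set.range g))
    (A : Matrix (κ → α) (κ → α) ℂ) (B : Matrix (μ → α) (μ → α) ℂ) :
    actAt f A * actAt g B = actAt g B * actAt f A := by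
  classical
  ext u v
  rw [actAt_mul_actAt_apply hfg, actAt_mul_actAt_apply hfg.symm, mul_comm]
  exact if_congr ⟨fun h m h1 h2 => h m h2 h1, fun h m h1 h2 => h m h2 h1⟩ rfl rfl

variable [Fintype κ]

/-- The identity on the remaining factors is positive definite, and so is a Kronecker product of
positive definite matrices. -/
theorem PosDef.actAt {A : Matrix (κ → α) (κ → α) ℂ} (hA : A.PosDef) (hf : f.Injective) :
    (actAt f A).PosDef := by
  classical
  rw [actAt_eq_kronecker hf]
  exact (hA.kronecker PosDef.one).submatrix (Equiv.injective _)

theorem PosSemidef.actAt {A : Matrix (κ → α) (κ → α) ℂ} (hA : A.PosSemidef) (hf : f.Injective) :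
    (actAt f A).PosSemidef := by
  classical
  rw [actAt_eq_kronecker hf]
  exact (hA.kronecker PosSemidef.one).submatrix _

theorem actAt_mul [DecidableEq κ] (hf : f.Injective) (A B : Matrix (κ → α) (κ → α) ℂ) :
    actAt f (A * B) = actAt f A * actAt f B := by
  classical
  rw [actAt_eq_kronecker hf, actAt_eq_kronecker hf, actAt_eq_kronecker hf, submatrix_mul_equiv,
    ← mul_kronecker_mul, one_mul]

end ActAt

end Matrix

/-! ### The operators `T_i`, `R_n` and `P_n` -/

namespace WickCoeff

open scoped Matrix
open Matrix

variable {d : ℕ} (T : WickCoeff d)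

/-- The operator `T` with its basis indexed by functions on `Fin 2` instead of pairs. -/
def opFin : Matrix (Fin 2 → Fin d) (Fin 2 → Fin d) ℂ :=
  T.op.submatrix (fun u => (u 0, u 1)) (fun u => (u 0, u 1))

/-- The positions `i` and `i + 1` among `n + 1` tensor factors. -/
def adjacent {n : ℕ} (i : Fin n) : Fin 2 → Fin (n + 1) := ![i.castSucc, i.succ]

theorem adjacent_injective {n : ℕ} (i : Fin n) : (adjacent i).Injective := by
  intro a b
  fin_cases a <;> fin_cases b <;> simp [adjacent, Fin.ext_iff]

theorem opAt_eq_actAt (n : ℕ) (i : Fin n) : T.opAt n i = actAt (adjacent i) T.opFin := by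
  ext u v
  have h : (∀ m, m ≠ i.castSucc → m ≠ i.succ → u m = v m) ↔
      ∀ m, m ∉ Set.range (adjacent i) → u m = v m := by
    refine forall_congr' fun m => ?_
    simp only [adjacent, range_cons, range_empty, Set.union_empty, Set.mem_union,
      Set.mem_singleton_iff, not_or, and_imp, ne_eq]
  rw [opAt, actAt, of_apply, of_apply]
  by_cases hm : ∀ m, m ≠ i.castSucc → m ≠ i.succ → u m = v m
  · rw [if_pos hm, if_pos (h.1 hm)]
    rfl
  · rw [if_neg hm, if_neg (mt h.2 hm)]

theorem oneTensor_eq_actAt {n : ℕ} (A : Matrix (Fin n → Fin d) (Fin n → Fin d) ℂ) :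
    oneTensor A = actAt Fin.succ A := by
  ext u v
  have h : u 0 = v 0 ↔ ∀ m, m ∉ Set.range Fin.succ → u m = v m := by
    simp
  rw [oneTensor, actAt, of_apply, of_apply]
  by_cases hm : u 0 = v 0
  · rw [if_pos hm, if_pos (h.1 hm)]
    rfl
  · rw [if_neg hm, if_neg (mt h.2 hm)]

theorem oneTensor_opAt (n : ℕ) (i : Fin n) : oneTensor (T.opAt n i) = T.opAt (n + 1) i.succ := by
  rw [oneTensor_eq_actAt, opAt_eq_actAt, actAt_actAt (Fin.succ_injective _), opAt_eq_actAt]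
  congr 1
  funext k
  fin_cases k <;> rfl

theorem oneTensor_one (n : ℕ) : oneTensor (1 : Matrix (Fin n → Fin d) _ ℂ) = 1 := by
  rw [oneTensor_eq_actAt, actAt_one (Fin.succ_injective _)]

theorem oneTensor_mul {n : ℕ} (A B : Matrix (Fin n → Fin d) (Fin n → Fin d) ℂ) :
    oneTensor (A * B) = oneTensor A * oneTensor B := by
  simp only [oneTensor_eq_actAt, actAt_mul (Fin.succ_injective _)]

theorem conjTranspose_oneTensor {n : ℕ} (A : Matrix (Fin n → Fin d) (Fin n → Fin d) ℂ) :
    (oneTensor A)ᴴ = oneTensor Aᴴ := by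
  simp only [oneTensor_eq_actAt, conjTranspose_actAt]

theorem conjTranspose_opAt (n : ℕ) (i : Fin n) : (T.opAt n i)ᴴ = T.opAt n i := by
  rw [opAt_eq_actAt, conjTranspose_actAt]
  congr 1
  ext u v
  simp only [opFin, op, conjTranspose_apply, submatrix_apply, of_apply]
  exact (T.herm _ _ _ _).symm

theorem opAt_fixOrShrink (hlower : (1 + T.op).PosDef) (hupper : (1 - T.op).PosSemidef) (n : ℕ)
    (i : Fin n) : FixOrShrink (T.opAt n i) := by
  have hinj : Function.Injective (fun u : Fin 2 → Fin d => (u 0, u 1)) := by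
    intro u v h
    funext k
    fin_cases k
    · exact (Prod.mk.inj h).1
    · exact (Prod.mk.inj h).2
  have hone : (1 : Matrix (Fin 2 → Fin d) (Fin 2 → Fin d) ℂ) =
      (1 : Matrix (Fin d × Fin d) (Fin d × Fin d) ℂ).submatrix (fun u => (u 0, u 1))
        (fun u => (u 0, u 1)) := (submatrix_one _ hinj).symm
  rw [opAt_eq_actAt]
  refine .of_posDef_of_posSemidef ?_ ?_
  · rw [← actAt_one (adjacent_injective i), ← actAt_add]
    refine PosDef.actAt ?_ (adjacent_injective i)
    rw [hone]
    exact hlower.submatrix hinj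
  · rw [← actAt_one (adjacent_injective i), ← actAt_sub]
    refine PosSemidef.actAt ?_ (adjacent_injective i)
    rw [hone]
    exact hupper.submatrix _

/-- The operators `T_1, …, T_n` on the `(n+1)`-st tensor power as a sequence, counted from `0` and
continued by `1`. -/
def opSeq (n i : ℕ) : Matrix (Fin (n + 1) → Fin d) (Fin (n + 1) → Fin d) ℂ :=
  if h : i < n then T.opAt n ⟨i, h⟩ else 1

theorem opSeq_of_lt {n i : ℕ} (h : i < n) : T.opSeq n i = T.opAt n ⟨i, h⟩ := dif_pos h

theorem disjoint_range_adjacent {n : ℕ} {i j : Fin n} (h : i.1 + 2 ≤ j.1) :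
    Disjoint (Set.range (adjacent i)) (Set.range (adjacent j)) := by
  rw [Set.disjoint_left]
  rintro _ ⟨a, rfl⟩ ⟨b, hb⟩
  fin_cases a <;> fin_cases b <;> simp [adjacent, Fin.ext_iff] at hb <;> omega

/-- Three consecutive factors of the `(n+1)`-st tensor power carry a copy of the braid condition
on `H ⊗ H ⊗ H`. -/
theorem IsBraided.braidRelations {T : WickCoeff d} (hT : T.IsBraided) (n : ℕ) :
    BraidRelations (T.opSeq n) n where
  braid i hi := by
    let f : Fin 3 → Fin (n + 1) := fun k => ⟨i + k, by omega⟩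
    have hf : f.Injective := fun a b hab => by
      have := congrArg Fin.val hab
      exact Fin.ext (by simpa [f] using this)
    have h0 : T.opSeq n i = actAt f (T.opAt 2 0) := by
      rw [opSeq_of_lt T (by omega), opAt_eq_actAt, opAt_eq_actAt, actAt_actAt hf]
      congr 1
      funext k
      fin_cases k <;> rfl
    have h1 : T.opSeq n (i + 1) = actAt f (T.opAt 2 1) := by
      rw [opSeq_of_lt T hi, opAt_eq_actAt, opAt_eq_actAt, actAt_actAt hf]
      congr 1
      funext k
      fin_cases k <;> rfl
    simp only [h0, h1, ← actAt_mul hf]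
    exact congrArg _ hT
  comm i j hij hj := by
    rw [opSeq_of_lt T (by omega), opSeq_of_lt T hj, opAt_eq_actAt, opAt_eq_actAt]
    exact actAt_commute (disjoint_range_adjacent hij) _ _

theorem R_eq_sum_cycleProd (n : ℕ) :
    T.R n = ∑ k ∈ Finset.range (n + 1), cycleProd (T.opSeq n) k := by
  refine Finset.sum_congr rfl fun k hk => ?_
  have hk' : k ≤ n := Nat.lt_succ_iff.1 (Finset.mem_range.1 hk)
  clear hk
  induction k with
  | zero => simp [cycleProd]
  | succ k ih =>
    rw [List.prod_take_succ _ _ (by simpa using hk'), ih (by omega), cycleProd,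
      opSeq_of_lt T (by omega)]
    simp

theorem isUnit_R (hT : T.IsBraided) (hlower : (1 + T.op).PosDef)
    (hupper : (1 - T.op).PosSemidef) (n : ℕ) : IsUnit (T.R n) := by
  rw [R_eq_sum_cycleProd]
  refine isUnit_sum_cycleProd (hT.braidRelations n) (fun i hi => ?_) fun i hi => ?_
  · rw [opSeq_of_lt T hi, conjTranspose_opAt]
  · rw [opSeq_of_lt T hi]
    exact T.opAt_fixOrShrink hlower hupper n _

theorem isUnit_P (hT : T.IsBraided) (hlower : (1 + T.op).PosDef)
    (hupper : (1 - T.op).PosSemidef) (n : ℕ) : IsUnit (T.P n) := by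
  induction n with
  | zero => exact isUnit_one
  | succ n ih =>
    obtain ⟨B, hB⟩ := isUnit_iff_exists_inv.1 ih
    refine IsUnit.mul ?_ (T.isUnit_R hT hlower hupper n)
    refine IsUnit.of_mul_eq_one (oneTensor B) ?_
    rw [← oneTensor_mul, hB, oneTensor_one]

theorem R_zero : T.R 0 = 1 := by
  simp [R]

theorem R_succ (n : ℕ) : T.R (n + 1) = 1 + T.opAt (n + 1) 0 * oneTensor (T.R n) := by
  have h : ∀ k ≤ n, oneTensor (cycleProd (T.opSeq n) k) =
      cycleProd (fun i => T.opSeq (n + 1) (i + 1)) k := by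
    intro k
    induction k with
    | zero => exact fun _ => oneTensor_one _
    | succ k ih =>
      intro hk
      rw [cycleProd, oneTensor_mul, ih (by omega), cycleProd, opSeq_of_lt T (by omega),
        opSeq_of_lt T (by omega), oneTensor_opAt]
      rfl
  rw [R_eq_sum_cycleProd, Finset.sum_range_succ', R_eq_sum_cycleProd, oneTensor_eq_actAt,
    actAt_sum, Finset.mul_sum]
  refine (add_comm _ _).trans (congrArg (1 + ·) ?_)
  refine Finset.sum_congr rfl fun k hk => ?_
  rw [cycleProd_succ', ← oneTensor_eq_actAt, h k (Nat.lt_succ_iff.1 (Finset.mem_range.1 hk)),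
    opSeq_of_lt T (Nat.succ_pos n)]
  rfl

/-- `T_1` commutes with `1 ⊗ 1 ⊗ A`. -/
theorem opAt_zero_mul_oneTensor_oneTensor {n : ℕ} (A : Matrix (Fin n → Fin d) (Fin n → Fin d) ℂ) :
    T.opAt (n + 1) 0 * oneTensor (oneTensor A) = oneTensor (oneTensor A) * T.opAt (n + 1) 0 := by
  rw [oneTensor_eq_actAt, oneTensor_eq_actAt, actAt_actAt (Fin.succ_injective _), opAt_eq_actAt]
  refine actAt_commute ?_ _ _
  rw [Set.disjoint_left]
  rintro _ ⟨a, rfl⟩ ⟨b, hb⟩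
  fin_cases a <;> simp [adjacent, Fin.ext_iff] at hb

/-- `P_n` is Hermitian, even without the braid condition: `P_{n+2}` equals
`1 ⊗ P_{n+1} + (1 ⊗ R_{n+1})ᴴ (1 ⊗ 1 ⊗ P_n) T_1 (1 ⊗ R_{n+1})`. -/
theorem isHermitian_P (n : ℕ) : (T.P n).IsHermitian := by
  induction n using Nat.twoStepInduction with
  | zero => exact isHermitian_one
  | one =>
    change (oneTensor 1 * T.R 0)ᴴ = oneTensor 1 * T.R 0
    rw [R_zero, oneTensor_one, mul_one, conjTranspose_one]
  | more n h0 h1 =>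
    have hP : T.P (n + 1) = oneTensor (T.P n) * T.R n := rfl
    have hP' : (T.R n)ᴴ * oneTensor (T.P n) = T.P (n + 1) := by
      conv_rhs => rw [← h1.eq, hP, conjTranspose_mul, conjTranspose_oneTensor, h0.eq]
    have hform : T.P (n + 2) = oneTensor (T.P (n + 1)) + (oneTensor (T.R n))ᴴ *
        (oneTensor (oneTensor (T.P n)) * T.opAt (n + 1) 0) * oneTensor (T.R n) := by
      change oneTensor (T.P (n + 1)) * T.R (n + 1) = _
      rw [R_succ, mul_add, mul_one, conjTranspose_oneTensor]
      simp only [← mul_assoc]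
      rw [← oneTensor_mul, hP']
    rw [hform, IsHermitian, conjTranspose_add, conjTranspose_oneTensor, h1.eq]
    congr 1
    simp only [conjTranspose_mul, conjTranspose_oneTensor, conjTranspose_conjTranspose, h0.eq,
      conjTranspose_opAt, mul_assoc]
    rw [← mul_assoc (T.opAt _ _), opAt_zero_mul_oneTensor_oneTensor, mul_assoc]

/-- The coefficients `q T_{ij}^{kl}` for a real number `q`. -/
def scale (q : ℝ) : WickCoeff d where
  coeff i j k l := q * T.coeff i j k l
  herm i j k l := by rw [T.herm i j k l, map_mul, Complex.conj_ofReal]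

theorem scale_one : T.scale 1 = T := by
  cases T
  simp [scale]

theorem op_scale (q : ℝ) : (T.scale q).op = q • T.op := by
  ext u v
  simp [op, scale]

theorem opAt_scale (q : ℝ) (n : ℕ) (i : Fin n) : (T.scale q).opAt n i = q • T.opAt n i := by
  ext u v
  simp [opAt, op_scale]

theorem IsBraided.scale {T : WickCoeff d} (hT : T.IsBraided) (q : ℝ) :
    (T.scale q).IsBraided := by
  unfold IsBraided
  simp only [opAt_scale, smul_mul_assoc, mul_smul_comm]
  rw [hT]

theorem posDef_one_add_op_scale (hlower : (1 + T.op).PosDef) {q : ℝ} (hq : q ∈ Set.Icc (0 : ℝ) 1) :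
    (1 + (T.scale q).op).PosDef := by
  have h : 1 + (T.scale q).op = (1 - q) • (1 : Matrix (Fin d × Fin d) _ ℂ) + q • (1 + T.op) := by
    rw [op_scale, smul_add, sub_smul, one_smul]
    abel
  rw [h]
  rcases hq.1.eq_or_lt with rfl | h0
  · simpa using PosDef.one
  · exact (hlower.smul h0).posSemidef_add (PosSemidef.one.smul (sub_nonneg.2 hq.2))

theorem posSemidef_one_sub_op_scale (hupper : (1 - T.op).PosSemidef) {q : ℝ}
    (hq : q ∈ Set.Icc (0 : ℝ) 1) : (1 - (T.scale q).op).PosSemidef := by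
  have h : 1 - (T.scale q).op = (1 - q) • (1 : Matrix (Fin d × Fin d) _ ℂ) + q • (1 - T.op) := by
    rw [op_scale, smul_sub, sub_smul, one_smul]
    abel
  rw [h]
  exact (PosSemidef.one.smul (sub_nonneg.2 hq.2)).add (hupper.smul hq.1)

theorem continuous_oneTensor {n : ℕ} :
    Continuous (oneTensor : Matrix (Fin n → Fin d) (Fin n → Fin d) ℂ → _) := by
  refine continuous_matrix fun u v => ?_
  simp only [oneTensor, of_apply]
  split_ifs
  · exact continuous_id.matrix_elem _ _
  · exact continuous_const

theorem continuous_R_scale (n : ℕ) : Continuous fun q : ℝ => (T.scale q).R n := by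
  induction n with
  | zero => simp only [R_zero, continuous_const]
  | succ n ih =>
    simp only [R_succ, opAt_scale]
    exact continuous_const.add
      ((continuous_id.smul continuous_const).mul (continuous_oneTensor.comp ih))

theorem continuous_P_scale (n : ℕ) : Continuous fun q : ℝ => (T.scale q).P n := by
  induction n with
  | zero => exact continuous_const
  | succ n ih => exact (continuous_oneTensor.comp ih).mul (T.continuous_R_scale n)

theorem P_scale_zero (n : ℕ) : (T.scale 0).P n = 1 := by
  have hR : ∀ m, (T.scale 0).R m = 1 := by
    intro m
    cases m with
    | zero => exact R_zero _
    | succ m => rw [R_succ, opAt_scale, zero_smul, zero_mul, add_zero]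
  induction n with
  | zero => rfl
  | succ n ih =>
    change oneTensor ((T.scale 0).P n) * (T.scale 0).R n = 1
    rw [ih, hR, oneTensor_one, one_mul]

/-- `P_n` is positive definite because along the path `q T`, `0 ≤ q ≤ 1`, it stays Hermitian and
invertible, and it is `1` at `q = 0`. -/
theorem posDef_P (hT : T.IsBraided) (hlower : (1 + T.op).PosDef)
    (hupper : (1 - T.op).PosSemidef) (n : ℕ) : (T.P n).PosDef := by
  have h := posDef_of_path (T.continuous_P_scale n) (fun q _ => (T.scale q).isHermitian_P n)
    (fun q hq => (T.scale q).isUnit_P (hT.scale q) (T.posDef_one_add_op_scale hlower hq)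
      (T.posSemidef_one_sub_op_scale hupper hq) n) (by rw [P_scale_zero]; exact .one)
  rwa [scale_one] at h

/-! ### Elementary tensors -/

theorem eWord_nil : (eWord [] : TensH d) = 1 := by
  simp [eWord]

theorem eWord_cons (i : Fin d) (w : List (Fin d)) : eWord (i :: w) = e i * eWord w := by
  simp [eWord]

theorem tensor_induction {p : TensH d → Prop} (hzero : p 0) (hadd : ∀ X Y, p X → p Y → p (X + Y))
    (hsmul : ∀ (c : ℂ) X, p X → p (c • X)) (hword : ∀ w : List (Fin d), p (eWord w))
    (X : TensH d) : p X := by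
  have hX := (wordBasis d).mem_span X
  induction hX using Submodule.span_induction with
  | mem X hX =>
    obtain ⟨w, rfl⟩ := hX
    rw [wordBasis_apply]
    exact hword _
  | zero => exact hzero
  | add X Y _ _ hX hY => exact hadd X Y hX hY
  | smul c X _ hX => exact hsmul c X hX

theorem wordBasis_ofList (w : List (Fin d)) : wordBasis d (FreeMonoid.ofList w) = eWord w := by
  rw [wordBasis_apply, FreeMonoid.toList_ofList]

/-! ### Annihilation operators in coordinates -/

theorem sum_cons {α β : Type*} [Fintype α] [AddCommMonoid β] {n : ℕ}
    (g : (Fin (n + 1) → α) → β) : ∑ u, g u = ∑ a, ∑ u : Fin n → α, g (Fin.cons a u) := by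
  rw [← (Fin.consEquiv fun _ => α).sum_comp, Fintype.sum_prod_type]
  rfl

theorem oneTensor_cons {n : ℕ} (A : Matrix (Fin n → Fin d) (Fin n → Fin d) ℂ) (i j : Fin d)
    (u v : Fin n → Fin d) :
    oneTensor A (Fin.cons i u) (Fin.cons j v) = if i = j then A u v else 0 := by
  simp [oneTensor]

theorem opAt_zero_cons {n : ℕ} (i l j k : Fin d) (u v : Fin n → Fin d) :
    T.opAt (n + 1) 0 (Fin.cons i (Fin.cons l u)) (Fin.cons j (Fin.cons k v)) =
      if u = v then T.coeff i j k l else 0 := by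
  simp only [opAt, of_apply, Fin.forall_fin_succ (n := n + 1), Fin.forall_fin_succ (n := n)]
  simp [op, funext_iff, Fin.ext_iff]

/-- On the `(n+1)`-st tensor power, the annihilation operator `λ₀(a_i^*)` is `R_{n+1}` (which is
`T.R n`) followed by the removal of a first factor `e_i`. -/
theorem annihWord_ofFn {n : ℕ} (v : Fin (n + 1) → Fin d) (i : Fin d) :
    T.annihWord (List.ofFn v) i =
      ∑ w : Fin n → Fin d, T.R n (Fin.cons i w) v • eWord (List.ofFn w) := by
  induction n generalizing i with
  | zero =>
    obtain ⟨j, v, rfl⟩ : ∃ j v', v = Fin.cons j v' := ⟨_, _, (Fin.cons_self_tail v).symm⟩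
    simp [annihWord, R_zero, one_apply, ite_smul, Subsingleton.elim default v]
  | succ n ih =>
    obtain ⟨j, v, rfl⟩ : ∃ j v', v = Fin.cons j v' := ⟨_, _, (Fin.cons_self_tail v).symm⟩
    rw [List.ofFn_cons, annihWord, R_succ]
    simp only [Matrix.add_apply, add_smul, Finset.sum_add_distrib]
    congr 1
    · simp only [one_apply, Fin.cons_inj, ite_and, ite_smul, one_smul, zero_smul]
      split_ifs <;> simp
    -- summation over first and second factors: `T_1` takes `e_j ⊗ e_k` to the multiples
    -- `T_{ij}^{kl}` of `e_i ⊗ e_l`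
    · have h : ∀ l (w : Fin n → Fin d),
          (T.opAt (n + 1) 0 * oneTensor (T.R n)) (Fin.cons i (Fin.cons l w)) (Fin.cons j v) =
            ∑ k, T.coeff i j k l * T.R n (Fin.cons k w) v := by
        intro l w
        rw [mul_apply, sum_cons, Finset.sum_eq_single j]
        · rw [sum_cons]
          refine Finset.sum_congr rfl fun k _ => ?_
          rw [Finset.sum_eq_single w]
          · rw [opAt_zero_cons, oneTensor_cons, if_pos rfl, if_pos rfl]
          · intro x _ hx
            rw [opAt_zero_cons, if_neg (Ne.symm hx), zero_mul]
          · simp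
        · intro a _ ha
          refine Finset.sum_eq_zero fun x _ => ?_
          rw [oneTensor_cons, if_neg ha, mul_zero]
        · simp
      rw [sum_cons, Finset.sum_comm]
      refine Finset.sum_congr rfl fun l _ => ?_
      simp only [h, ih, Finset.mul_sum, Finset.smul_sum, Finset.sum_smul]
      rw [Finset.sum_comm]
      refine Finset.sum_congr rfl fun w _ => Finset.sum_congr rfl fun k _ => ?_
      rw [List.ofFn_cons, eWord_cons, mul_smul_comm, smul_smul]

/-! ### Construction and uniqueness of the form -/

/-- The linear functional `Y ↦ ⟨e_{i_1} ⊗ ⋯ ⊗ e_{i_n}, Y⟩₀`, that is, the vacuum coefficient of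
`λ₀(a_{i_n}^*) ⋯ λ₀(a_{i_1}^*) Y`. -/
noncomputable def wordFunctional : List (Fin d) → (TensH d →ₗ[ℂ] ℂ)
  | [] => (wordBasis d).coord 1
  | i :: w => wordFunctional w ∘ₗ T.annihilation i

/-- The Fock inner product, the conjugate-linear extension of `wordFunctional`. -/
noncomputable def fockForm : TensH d →ₗ⋆[ℂ] TensH d →ₗ[ℂ] ℂ where
  toFun X := ((wordBasis d).repr X).sum fun w c => conj c • T.wordFunctional w.toList
  map_add' X Y := by
    rw [map_add]
    refine Finsupp.sum_add_index' (fun w => ?_) fun w c c' => ?_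
    · rw [map_zero, zero_smul]
    · rw [map_add, add_smul]
  map_smul' c X := by
    rw [map_smul]
    refine (Finsupp.sum_smul_index fun w => ?_).trans ?_
    · rw [map_zero, zero_smul]
    · rw [Finsupp.smul_sum]
      simp only [map_mul, mul_smul]

theorem fockForm_eWord (w : List (Fin d)) : T.fockForm (eWord w) = T.wordFunctional w := by
  change ((wordBasis d).repr (eWord w)).sum
    (fun w c => conj c • T.wordFunctional w.toList) = _
  rw [← wordBasis_ofList, Module.Basis.repr_self, Finsupp.sum_single_index (by simp)]
  simp

theorem coord_one_eWord (w : List (Fin d)) :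
    (wordBasis d).coord 1 (eWord w) = if w = [] then 1 else 0 := by
  rw [← wordBasis_ofList, Module.Basis.coord_apply, Module.Basis.repr_self]
  split_ifs with h
  · rw [h, FreeMonoid.ofList_nil, Finsupp.single_eq_same]
  · refine Finsupp.single_eq_of_ne fun h' => h (FreeMonoid.ofList.injective ?_)
    rw [← h', FreeMonoid.ofList_nil]

theorem wordFunctional_eWord_of_length_ne {n m : ℕ} (h : n ≠ m) (u : Fin n → Fin d)
    (v : Fin m → Fin d) : T.wordFunctional (List.ofFn u) (eWord (List.ofFn v)) = 0 := by
  induction n generalizing m with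
  | zero =>
    rw [List.ofFn_zero, wordFunctional, coord_one_eWord, if_neg]
    rw [List.ofFn_eq_nil_iff]
    exact h.symm
  | succ n ih =>
    rw [List.ofFn_succ, wordFunctional, LinearMap.comp_apply, annihilation_eWord]
    cases m with
    | zero => rw [List.ofFn_zero, annihWord, map_zero]
    | succ m =>
      rw [annihWord_ofFn, map_sum]
      refine Finset.sum_eq_zero fun w _ => ?_
      rw [map_smul, ih (by omega), smul_zero]

/-- On the `n`-th tensor power the Fock inner product is given by `P_n`. -/
theorem wordFunctional_eWord {n : ℕ} (u v : Fin n → Fin d) :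
    T.wordFunctional (List.ofFn u) (eWord (List.ofFn v)) = T.P n u v := by
  induction n with
  | zero =>
    rw [List.ofFn_zero, wordFunctional, coord_one_eWord, if_pos (List.ofFn_zero), P,
      Subsingleton.elim u v, one_apply_eq]
  | succ n ih =>
    obtain ⟨i, u, rfl⟩ : ∃ i u', u = Fin.cons i u' := ⟨_, _, (Fin.cons_self_tail u).symm⟩
    rw [List.ofFn_cons, wordFunctional, LinearMap.comp_apply, annihilation_eWord, annihWord_ofFn,
      map_sum, P, mul_apply, sum_cons, Finset.sum_eq_single i]
    · refine Finset.sum_congr rfl fun w _ => ?_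
      rw [map_smul, ih, oneTensor_cons, if_pos rfl, smul_eq_mul, mul_comm]
    · intro j _ hj
      refine Finset.sum_eq_zero fun w _ => ?_
      rw [oneTensor_cons, if_neg (Ne.symm hj), zero_mul]
    · simp

theorem exists_eq_ofFn {α : Type*} (w : List α) : ∃ (n : ℕ) (u : Fin n → α), w = List.ofFn u :=
  ⟨w.length, w.get, (List.ofFn_get w).symm⟩

theorem fockForm_hermitian (X Y : TensH d) : conj (T.fockForm X Y) = T.fockForm Y X := by
  induction X using tensor_induction with
  | hzero => simp
  | hadd X X' hX hX' => simp [hX, hX']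
  | hsmul c X hX => simp [hX]
  | hword w =>
    induction Y using tensor_induction with
    | hzero => simp
    | hadd Y Y' hY hY' => simp [hY, hY']
    | hsmul c Y hY => simp [hY]
    | hword w' =>
      obtain ⟨n, u, rfl⟩ := exists_eq_ofFn w
      obtain ⟨m, v, rfl⟩ := exists_eq_ofFn w'
      rw [fockForm_eWord, fockForm_eWord]
      rcases eq_or_ne n m with rfl | h
      · rw [wordFunctional_eWord, wordFunctional_eWord]
        exact (T.isHermitian_P n).apply v u
      · rw [wordFunctional_eWord_of_length_ne T h, wordFunctional_eWord_of_length_ne T h.symm,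
          map_zero]

theorem fock_aStar (i : Fin d) : T.fock (T.aStar i) = T.annihilation i :=
  T.lift_aStar _ _ _ i

theorem star_aStar (i : Fin d) : star (T.aStar i) = T.a i := by
  rw [← star_a, star_star]

theorem fockForm_creation (i : Fin d) (X Y : TensH d) :
    T.fockForm (e i * X) Y = T.fockForm X (T.annihilation i Y) := by
  induction X using tensor_induction with
  | hzero => simp
  | hadd X X' hX hX' => simp [mul_add, hX, hX']
  | hsmul c X hX => simp [hX]
  | hword w =>
    rw [← eWord_cons, fockForm_eWord, fockForm_eWord, wordFunctional, LinearMap.comp_apply]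

theorem isFockInnerProduct_fockForm : T.IsFockInnerProduct T.fockForm where
  hermitian := T.fockForm_hermitian
  vacuum := by
    rw [← eWord_nil, fockForm_eWord, wordFunctional, coord_one_eWord, if_pos rfl]
  star_rep w := by
    induction w using T.wick_induction with
    | hc c =>
      intro X Y
      rw [← algebraMap_star_comm, AlgHom.commutes, AlgHom.commutes]
      simp [Module.algebraMap_end_apply]
    | ha i =>
      intro X Y
      rw [fock_a, star_a, fock_aStar, fockForm_creation]
    | hs i =>
      intro X Y
      rw [star_aStar, fock_a, fock_aStar, ← fockForm_hermitian, ← fockForm_creation,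
        fockForm_hermitian]
    | hm x y hx hy =>
      intro X Y
      rw [star_mul, map_mul, map_mul, Module.End.mul_apply, Module.End.mul_apply, hx, hy]
    | hadd x y hx hy =>
      intro X Y
      rw [star_add, map_add, map_add, LinearMap.add_apply, LinearMap.add_apply, map_add, map_add,
        LinearMap.add_apply, hx, hy]

/-- The relations `⟨1, e_i ⊗ Y⟩ = ⟨λ₀(a_i^*) 1, Y⟩ = 0` and
`⟨e_i ⊗ X, Y⟩ = ⟨X, λ₀(a_i^*) Y⟩` determine a Fock inner product. -/
theorem IsFockInnerProduct.eq_fockForm {T : WickCoeff d}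
    {B : TensH d →ₗ⋆[ℂ] TensH d →ₗ[ℂ] ℂ} (hB : T.IsFockInnerProduct B) : B = T.fockForm := by
  have hword : ∀ w : List (Fin d), B (eWord w) = T.wordFunctional w := by
    intro w
    induction w with
    | nil =>
      refine (wordBasis d).ext fun v => ?_
      rw [wordBasis_apply, wordFunctional, coord_one_eWord, eWord_nil]
      cases h : v.toList with
      | nil => rw [eWord_nil, hB.vacuum, if_pos rfl]
      | cons i v =>
        rw [eWord_cons, ← fock_a T, ← star_aStar, ← hB.star_rep, fock_aStar_one, map_zero,
          LinearMap.zero_apply, if_neg (List.cons_ne_nil _ _)]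
    | cons i w ih =>
      ext1 Y
      rw [eWord_cons, ← fock_a T, hB.star_rep, star_a, fock_aStar, ih, wordFunctional,
        LinearMap.comp_apply]
  refine (wordBasis d).ext fun w => ?_
  rw [wordBasis_apply, hword, fockForm_eWord]

/-! ### Strict positivity -/

/-- The vector in the `n`-th tensor power with coordinates `x`. -/
noncomputable def tensorVec {n : ℕ} (x : (Fin n → Fin d) → ℂ) : TensH d :=
  ∑ u, x u • eWord (List.ofFn u)

theorem fockForm_tensorVec {n : ℕ} (x y : (Fin n → Fin d) → ℂ) :
    T.fockForm (tensorVec x) (tensorVec y) = star x ⬝ᵥ (T.P n *ᵥ y) := by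
  simp only [tensorVec, map_sum, map_smulₛₗ, LinearMap.sum_apply, LinearMap.smul_apply,
    fockForm_eWord, wordFunctional_eWord, dotProduct, mulVec, Finset.mul_sum, smul_eq_mul,
    Pi.star_apply, RCLike.star_def, RingHom.id_apply]
  rw [Finset.sum_comm]
  refine Finset.sum_congr rfl fun u _ => Finset.sum_congr rfl fun v _ => ?_
  ring

theorem fockForm_tensorVec_of_ne {n m : ℕ} (h : n ≠ m) (x : (Fin n → Fin d) → ℂ)
    (y : (Fin m → Fin d) → ℂ) : T.fockForm (tensorVec x) (tensorVec y) = 0 := by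
  simp only [tensorVec, map_sum, map_smulₛₗ, LinearMap.sum_apply, LinearMap.smul_apply,
    fockForm_eWord, wordFunctional_eWord_of_length_ne T h, smul_zero, Finset.sum_const_zero]

theorem exists_eq_sum_tensorVec (X : TensH d) :
    ∃ (N : ℕ) (x : ∀ n, (Fin n → Fin d) → ℂ), X = ∑ n ∈ Finset.range N, tensorVec (x n) := by
  let b := (wordBasis d).reindex (FreeMonoid.toList.trans List.equivSigmaTuple)
  have hb : ∀ s, b s = eWord (List.ofFn s.2) := fun s => by
    rw [Module.Basis.reindex_apply, wordBasis_apply]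
    rfl
  refine ⟨(b.repr X).support.sup Sigma.fst + 1, fun n u => b.repr X ⟨n, u⟩, ?_⟩
  conv_lhs => rw [← b.linearCombination_repr X]
  have hsub : (b.repr X).support ⊆
      (Finset.range ((b.repr X).support.sup Sigma.fst + 1)).sigma fun _ => Finset.univ := by
    intro s hs
    simp only [Finset.mem_sigma, Finset.mem_range, Finset.mem_univ, and_true]
    exact Nat.lt_succ_of_le (Finset.le_sup (f := Sigma.fst) hs)
  rw [Finsupp.linearCombination_apply, Finsupp.sum_of_support_subset _ hsub _ (by simp),
    Finset.sum_sigma]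
  simp only [hb, tensorVec]

/-- Tensor powers of different degrees are orthogonal, and on each of them the form is given by a
positive definite matrix. -/
theorem fockForm_self_pos (hP : ∀ n, (T.P n).PosDef) {X : TensH d} (hX : X ≠ 0) :
    0 < T.fockForm X X := by
  obtain ⟨N, x, rfl⟩ := exists_eq_sum_tensorVec X
  have hsum : T.fockForm (∑ n ∈ Finset.range N, tensorVec (x n))
      (∑ n ∈ Finset.range N, tensorVec (x n)) =
        ∑ n ∈ Finset.range N, star (x n) ⬝ᵥ (T.P n *ᵥ x n) := by
    rw [map_sum]
    refine Finset.sum_congr rfl fun n hn => ?_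
    rw [map_sum, LinearMap.sum_apply, Finset.sum_eq_single_of_mem n hn fun m _ hm =>
      T.fockForm_tensorVec_of_ne hm _ _, fockForm_tensorVec]
  obtain ⟨n, hn, hx⟩ : ∃ n ∈ Finset.range N, x n ≠ 0 := by
    by_contra! h
    refine hX (Finset.sum_eq_zero fun n hn => ?_)
    simp [tensorVec, h n hn]
  rw [hsum]
  exact Finset.sum_pos' (fun m _ => (hP m).posSemidef.dotProduct_mulVec_nonneg _)
    ⟨n, hn, (hP n).dotProduct_mulVec_pos hx⟩

end WickCoeff

theorem proposition5 (d : ℕ) (T : WickCoeff d) (hbraid : T.IsBraided)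
    (hlower : (1 + T.op).PosDef) (hupper : (1 - T.op).PosSemidef) :
    (∀ n, 2 ≤ n → (T.P n).PosDef) ∧
    ∃ B : WickCoeff.TensH d →ₗ⋆[ℂ] WickCoeff.TensH d →ₗ[ℂ] ℂ,
      T.IsFockInnerProduct B ∧
      (∀ B', T.IsFockInnerProduct B' → B' = B) ∧
      (∀ X, X ≠ 0 → 0 < B X X) ∧
      LinearMap.ker B = ⊥ := by
  have hP := T.posDef_P hbraid hlower hupper
  have hpos : ∀ X, X ≠ 0 → 0 < T.fockForm X X := fun X hX => T.fockForm_self_pos hP hX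
  refine ⟨fun n _ => hP n, T.fockForm, T.isFockInnerProduct_fockForm,
    fun B' hB' => hB'.eq_fockForm, hpos, LinearMap.ker_eq_bot'.2 fun X hX => ?_⟩
  by_contra hne
  have h := hpos X hne
  rw [hX] at h
  exact h.ne rfl
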